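/- **Theorem.** Let $a<b$ and $\lambda\ge 0$ be real numbers. The cut locations of a Mondrian process on $[a,b]$ run with lifetime $\lambda$ form a Poisson point process on $[a,b]$ with constant intensity $\lambda$. Here the terms have the following meaning. *Mondrian process on $[a,b]$.* It is the random infinite binary tree produced by the following recursive random procedure, called with the interval $[a,b]$ and start time $0$. Called with an interval $[c,d]$ and a start time $t_0$, the procedure draws independently $T\sim\mathrm{Exp}(d-c)$ (the exponential distribution with rate $d-c$) and $x\sim\mathcal U([c,d])$. It records a cut at location $x$ with birth time $t_0+T$. Then, given $(T,x)$, it calls itself independently on $[c,x]$ and on $[x,d]$, both with start time $t_0+T$, to generate the left and the right subtree. (Almost surely all intervals that occur have positive length.) The set $\Pi_\lambda$ of cut locations of the process run with lifetime $\lambda$ is the set of the locations of all cuts with birth time at most $\lambda$. *Poisson point process on $[a,b]$ with constant intensity $\lambda$.* It is a random countable set $\Pi$, almost surely contained in $[a,b]$, such that, writing $N(A):=|\Pi\cap A|$ and $m$ for Lebesgue measure, 1. $N(A)\sim\mathrm{Poisson}(\lambda\, m(A))$ for every Borel set $A\subseteq[a,b]$, and 2. $N(A_1),\dots,N(A_n)$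 are independent random variables whenever $A_1,\dots,A_n\subseteq[a,b]$ are pairwise disjoint Borel sets. The claim is that $\Pi_\lambda$ is a Poisson point process on $[a,b]$ with constant intensity $\lambda$. -/

import Mathlib

open MeasureTheory ProbabilityTheory Set
open scoped NNReal ENNReal

noncomputable section

/-- The hierarchical partition (k-d tree) returned by a run of the Mondrian process on an interval.
Nodes are addressed by words over `Bool` (`false` = left child, `true` = right child, first letter =
step taken at the root), and a node carries `(t_b, t_c, x)`: its birth time, its cut time and its cut
location. In dimension one the cut dimension carries no information. -/
abbrev MondrianTree : Type := List Bool → ℝ × ℝ × ℝ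

namespace MondrianTree

/-- The tree with root data `(tb, tc, x)`, left subtree `l` and right subtree `r`. -/
def node (tb tc x : ℝ) (l r : MondrianTree) : MondrianTree
  | [] => (tb, tc, x)
  | false :: w => l w
  | true :: w => r w

/-- The cut time of the node `w`, i.e. the birth time of the cut that splits it. -/
def cutTime (m : MondrianTree) (w : List Bool) : ℝ := (m w).2.1

/-- The location of the cut that splits the node `w`. -/
def cutLocation (m : MondrianTree) (w : List Bool) : ℝ := (m w).2.2

/-- The locations of the cuts that are present at time `t`: the cuts born after time `t` are
ignored. -/
def cutLocations (m : MondrianTree) (t : ℝ) : Set ℝ :=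
  {x | ∃ w, m.cutTime w ≤ t ∧ m.cutLocation w = x}

end MondrianTree

namespace Mondrian

/-- The uniform distribution on `[a, b]`. -/
def uniformIcc (a b : ℝ) : Measure ℝ := ProbabilityTheory.cond volume (Icc a b)

/-- The node `w` of the tree generated on `[a, b]` from start time `t₀`, when the draws at the
nodes are driven by the standardised draws `s`, where `s v` is a pair of a standard exponential
and a standard uniform draw. At the root, `T = e / (b - a)` is a draw from `Exp (b - a)` and
`x = a + u * (b - a)` is a draw from the uniform distribution on `[a, b]`; the left and the right
subtree are then generated on `[a, x]` and `[x, b]` from start time `t₀ + T`.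
That this generates the recursive procedure is proved in `lintegral_startedAt`. -/
def runAt : List Bool → (List Bool → ℝ × ℝ) → ℝ → ℝ → ℝ → ℝ × ℝ × ℝ
  | [], s, a, b, t₀ => (t₀, t₀ + (s []).1 / (b - a), a + (s []).2 * (b - a))
  | false :: w, s, a, b, t₀ =>
      runAt w (fun v => s (false :: v))
        a (a + (s []).2 * (b - a)) (t₀ + (s []).1 / (b - a))
  | true :: w, s, a, b, t₀ =>
      runAt w (fun v => s (true :: v))
        (a + (s []).2 * (b - a)) b (t₀ + (s []).1 / (b - a))

/-- The joint law of one standard exponential and one independent standard uniform draw. -/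
def drawLaw : Measure (ℝ × ℝ) := (expMeasure 1).prod (uniformIcc 0 1)

/-- Independent standard draws, one for each node. -/
def seedLaw : Measure (List Bool → ℝ × ℝ) := Measure.infinitePi fun _ => drawLaw

/-- The law of the Mondrian process on `[a, b]` started at time `t₀`. -/
def startedAt (a b t₀ : ℝ) : Measure MondrianTree :=
  seedLaw.map fun s w => runAt w s a b t₀

/-- The law `MP([a, b])` of the Mondrian process on `[a, b]`. -/
def law (a b : ℝ) : Measure MondrianTree := startedAt a b 0

/-! ### The law satisfies the recursive generative procedure -/

lemma isProbabilityMeasure_uniformIcc {a b : ℝ} (h : a < b) :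
    IsProbabilityMeasure (uniformIcc a b) := by
  apply cond_isProbabilityMeasure_of_finite <;> simp [h]

instance : IsProbabilityMeasure drawLaw := by
  have := isProbabilityMeasure_expMeasure (r := 1) one_pos
  have := isProbabilityMeasure_uniformIcc (a := 0) (b := 1) one_pos
  unfold drawLaw; infer_instance

instance : IsProbabilityMeasure seedLaw := by
  unfold seedLaw; infer_instance

lemma measurable_runAt (w : List Bool) : Measurable
    fun p : (List Bool → ℝ × ℝ) × ℝ × ℝ × ℝ => runAt w p.1 p.2.1 p.2.2.1 p.2.2.2 := by
  induction w with
  | nil => simp only [runAt]; fun_prop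
  | cons c w ih =>
    cases c
    · exact ih.comp (f := fun p : (List Bool → ℝ × ℝ) × ℝ × ℝ × ℝ =>
        ((fun v => p.1 (false :: v)), p.2.1, p.2.1 + (p.1 []).2 * (p.2.2.1 - p.2.1),
          p.2.2.2 + (p.1 []).1 / (p.2.2.1 - p.2.1))) (by fun_prop)
    · exact ih.comp (f := fun p : (List Bool → ℝ × ℝ) × ℝ × ℝ × ℝ =>
        ((fun v => p.1 (true :: v)), p.2.1 + (p.1 []).2 * (p.2.2.1 - p.2.1), p.2.2.1,
          p.2.2.2 + (p.1 []).1 / (p.2.2.1 - p.2.1))) (by fun_prop)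

lemma measurable_run : Measurable
    fun p : (List Bool → ℝ × ℝ) × ℝ × ℝ × ℝ =>
      (fun w => runAt w p.1 p.2.1 p.2.2.1 p.2.2.2 : MondrianTree) :=
  measurable_pi_lambda _ measurable_runAt

instance (a b t₀ : ℝ) : IsProbabilityMeasure (startedAt a b t₀) :=
  Measure.isProbabilityMeasure_map
    (measurable_run.comp (f := fun s => (s, a, b, t₀)) (by fun_prop)).aemeasurable

instance (a b : ℝ) : IsProbabilityMeasure (law a b) := by
  unfold law; infer_instance

lemma measurable_node : Measurable
    fun p : (ℝ × ℝ × ℝ) × MondrianTree × MondrianTree =>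
      MondrianTree.node p.1.1 p.1.2.1 p.1.2.2 p.2.1 p.2.2 := by
  refine measurable_pi_lambda _ fun w => ?_
  rcases w with _ | ⟨_ | _, w⟩ <;> simp only [MondrianTree.node] <;> fun_prop

/-- Assemble the draws at the root and in the two subtrees. -/
def glue (p : (ℝ × ℝ) × (List Bool → ℝ × ℝ) × (List Bool → ℝ × ℝ)) : List Bool → ℝ × ℝ
  | [] => p.1
  | false :: w => p.2.1 w
  | true :: w => p.2.2 w

lemma measurable_glue : Measurable glue := by
  refine measurable_pi_lambda _ fun w => ?_
  rcases w with _ | ⟨_ | _, w⟩ <;> simp only [glue] <;> fun_prop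

end Mondrian
namespace Mondrian
lemma map_glue : (drawLaw.prod (seedLaw.prod seedLaw)).map glue = seedLaw := by
  refine Measure.eq_infinitePi _ fun s t ht => ?_
  let c : Bool → List Bool ↪ List Bool := fun d => ⟨List.cons d, List.cons_injective⟩
  let s' : Bool → Finset (List Bool) := fun d => s.preimage (c d) (c d).injective.injOn
  let t₀ : Set (ℝ × ℝ) := if [] ∈ s then t [] else univ
  have hpre : glue ⁻¹' ((s : Set (List Bool)).pi t) =
      t₀ ×ˢ (((s' false : Set (List Bool)).pi fun w => t (false :: w)) ×ˢ
        ((s' true : Set (List Bool)).pi fun w => t (true :: w))) := by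
    ext ⟨z, l, r⟩
    simp only [mem_preimage, mem_prod, Set.mem_pi, Finset.mem_coe, s', Finset.mem_preimage, c, t₀]
    constructor
    · intro h
      refine ⟨?_, fun w hw => h _ hw, fun w hw => h _ hw⟩
      split_ifs with h0
      · exact h _ h0
      · trivial
    · rintro ⟨h0, hl, hr⟩ w hw
      rcases w with _ | ⟨_ | _, w⟩
      · rwa [if_pos hw] at h0
      · exact hl w hw
      · exact hr w hw
  have hs : s = s.filter (· = []) ∪ ((s' false).map (c false) ∪ (s' true).map (c true)) := by
    ext w
    rcases w with _ | ⟨_ | _, w⟩ <;> simp [s', c]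
  have hm : MeasurableSet ((s : Set (List Bool)).pi t) :=
    MeasurableSet.pi s.countable_toSet fun i _ => ht i
  have hd1 : Disjoint (s.filter (· = []))
      ((s' false).map (c false) ∪ (s' true).map (c true)) := by
    rw [Finset.disjoint_left]; intro w hw; simp at hw; simp [hw.2, c]
  have hd2 : Disjoint ((s' false).map (c false)) ((s' true).map (c true)) := by
    rw [Finset.disjoint_left]; intro w hw; simp [c] at hw ⊢; grind
  have h0 : ∏ w ∈ s.filter (· = []), drawLaw (t w) = drawLaw t₀ := by
    by_cases h : [] ∈ s
    · have : s.filter (· = []) = {[]} := by ext w; simp; grind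
      simp [this, h, t₀]
    · have : s.filter (· = []) = ∅ := by ext w; simp; grind
      simp [this, h, t₀]
  rw [Measure.map_apply measurable_glue hm, hpre, Measure.prod_prod, Measure.prod_prod]
  conv_rhs => rw [hs]
  rw [Finset.prod_union hd1, Finset.prod_union hd2, h0, Finset.prod_map, Finset.prod_map,
    seedLaw, Measure.infinitePi_pi _ fun i _ => ht _, Measure.infinitePi_pi _ fun i _ => ht _]
  rfl

lemma map_div_expMeasure {r : ℝ} (hr : 0 < r) :
    (expMeasure 1).map (fun e => e / r) = expMeasure r := by
  have h1 := isProbabilityMeasure_expMeasure (r := 1) one_pos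
  have h2 := isProbabilityMeasure_expMeasure hr
  have h3 : IsProbabilityMeasure ((expMeasure 1).map (fun e => e / r)) :=
    Measure.isProbabilityMeasure_map (by fun_prop)
  apply Measure.eq_of_cdf
  ext x
  rw [cdf_expMeasure_eq hr, cdf_eq_real, map_measureReal_apply (by fun_prop) measurableSet_Iic]
  have : (fun e : ℝ => e / r) ⁻¹' Iic x = Iic (x * r) := by
    ext y; simp [div_le_iff₀ hr]
  rw [this, ← cdf_eq_real, cdf_expMeasure_eq one_pos]
  simp only [mul_nonneg_iff_of_pos_right hr, one_mul]
  rw [mul_comm x r]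

lemma map_affine_uniformIcc {a b : ℝ} (h : a < b) :
    (uniformIcc 0 1).map (fun u => a + u * (b - a)) = uniformIcc a b := by
  have hr : 0 < b - a := sub_pos.2 h
  ext A hA
  rw [Measure.map_apply (by fun_prop) hA, uniformIcc, uniformIcc,
    cond_apply measurableSet_Icc, cond_apply measurableSet_Icc]
  have : Icc 0 1 ∩ (fun u => a + u * (b - a)) ⁻¹' A
      = (fun u => u * (b - a)) ⁻¹' ((fun u => a + u) ⁻¹' (Icc a b ∩ A)) := by
    ext u
    simp only [mem_inter_iff, mem_Icc, mem_preimage]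
    refine and_congr_left fun _ => and_congr ?_ ?_
    · rw [le_add_iff_nonneg_right, mul_nonneg_iff_of_pos_right hr]
    · rw [← le_sub_iff_add_le', mul_le_iff_le_one_left hr]
  rw [this, Real.volume_preimage_mul_right hr.ne', measure_preimage_add, Real.volume_Icc,
    Real.volume_Icc, abs_of_pos (inv_pos.2 hr), ENNReal.ofReal_inv_of_pos hr]
  simp

lemma run_glue (z : ℝ × ℝ) (l r : List Bool → ℝ × ℝ) (a b t₀ : ℝ) :
    (fun w => runAt w (glue (z, l, r)) a b t₀ : MondrianTree) =
      MondrianTree.node t₀ (t₀ + z.1 / (b - a)) (a + z.2 * (b - a))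
        (fun w => runAt w l a (a + z.2 * (b - a)) (t₀ + z.1 / (b - a)))
        (fun w => runAt w r (a + z.2 * (b - a)) b (t₀ + z.1 / (b - a))) := by
  funext w
  rcases w with _ | ⟨_ | _, w⟩ <;> rfl

lemma lintegral_startedAt_eq_seed (a b t₀ : ℝ) {F : MondrianTree → ℝ≥0∞} (hF : Measurable F) :
    ∫⁻ m, F m ∂startedAt a b t₀ = ∫⁻ s, F (fun w => runAt w s a b t₀) ∂seedLaw :=
  lintegral_map hF (measurable_run.comp (f := fun s => (s, a, b, t₀)) (by fun_prop))

/-- The recursive procedure: on `[a, b]` with start time `t₀`, draw `T` from `Exp (b - a)` and `x`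
uniformly from `[a, b]`, then independently generate a left tree on `[a, x]` and a right tree on
`[x, b]`, both with start time `t₀ + T`, and return the node with these data. -/
theorem lintegral_startedAt {a b : ℝ} (h : a < b) (t₀ : ℝ) {F : MondrianTree → ℝ≥0∞}
    (hF : Measurable F) :
    ∫⁻ m, F m ∂startedAt a b t₀ =
      ∫⁻ T, ∫⁻ x, ∫⁻ l, ∫⁻ r, F (MondrianTree.node t₀ (t₀ + T) x l r)
        ∂startedAt x b (t₀ + T) ∂startedAt a x (t₀ + T) ∂uniformIcc a b ∂expMeasure (b - a) := by
  have hr : 0 < b - a := sub_pos.2 h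
  have := isProbabilityMeasure_expMeasure (r := 1) one_pos
  have := isProbabilityMeasure_uniformIcc (a := 0) (b := 1) one_pos
  have := isProbabilityMeasure_expMeasure hr
  have := isProbabilityMeasure_uniformIcc h
  have hG : Measurable fun p : ((ℝ × ℝ) × (List Bool → ℝ × ℝ)) × (List Bool → ℝ × ℝ) =>
      F (MondrianTree.node t₀ (t₀ + p.1.1.1) p.1.1.2
        (fun w => runAt w p.1.2 a p.1.1.2 (t₀ + p.1.1.1))
        (fun w => runAt w p.2 p.1.1.2 b (t₀ + p.1.1.1))) := by
    refine hF.comp (measurable_node.comp (f := fun p :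
      ((ℝ × ℝ) × (List Bool → ℝ × ℝ)) × (List Bool → ℝ × ℝ) =>
        ((t₀, t₀ + p.1.1.1, p.1.1.2), (fun w => runAt w p.1.2 a p.1.1.2 (t₀ + p.1.1.1)),
        (fun w => runAt w p.2 p.1.1.2 b (t₀ + p.1.1.1)))) ?_)
    refine Measurable.prodMk (by fun_prop) (Measurable.prodMk ?_ ?_)
    · exact measurable_run.comp (f := fun p :
        ((ℝ × ℝ) × (List Bool → ℝ × ℝ)) × (List Bool → ℝ × ℝ) =>
        (p.1.2, a, p.1.1.2, t₀ + p.1.1.1)) (by fun_prop)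
    · exact measurable_run.comp (f := fun p :
        ((ℝ × ℝ) × (List Bool → ℝ × ℝ)) × (List Bool → ℝ × ℝ) =>
        (p.2, p.1.1.2, b, t₀ + p.1.1.1)) (by fun_prop)
  have hG1 := hG.lintegral_prod_right' (ν := seedLaw)
  have hG2 := hG1.lintegral_prod_right' (ν := seedLaw)
  have hR : ∀ T x : ℝ, ∫⁻ l, ∫⁻ r, F (MondrianTree.node t₀ (t₀ + T) x l r)
        ∂startedAt x b (t₀ + T) ∂startedAt a x (t₀ + T) =
      ∫⁻ l, ∫⁻ r, F (MondrianTree.node t₀ (t₀ + T) x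
        (fun w => runAt w l a x (t₀ + T)) (fun w => runAt w r x b (t₀ + T))) ∂seedLaw ∂seedLaw := by
    intro T x
    have hN : Measurable fun p : MondrianTree × MondrianTree =>
        F (MondrianTree.node t₀ (t₀ + T) x p.1 p.2) :=
      hF.comp (measurable_node.comp (f := fun p : MondrianTree × MondrianTree =>
        ((t₀, t₀ + T, x), p.1, p.2)) (by fun_prop))
    rw [lintegral_startedAt_eq_seed _ _ _ hN.lintegral_prod_right']
    refine lintegral_congr fun l => ?_
    exact lintegral_startedAt_eq_seed _ _ _
      (hN.comp (f := fun r => (_, r)) (by fun_prop))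
  simp only [hR]
  rw [lintegral_startedAt_eq_seed _ _ _ hF]
  have hrun : Measurable fun s : List Bool → ℝ × ℝ =>
      F (fun w => runAt w s a b t₀) :=
    hF.comp (measurable_run.comp (f := fun s => (s, a, b, t₀)) (by fun_prop))
  conv_lhs => rw [← map_glue]
  rw [lintegral_map hrun measurable_glue,
    lintegral_prod (fun z => F fun w => runAt w (glue z) a b t₀)
      (hrun.comp measurable_glue).aemeasurable,
    drawLaw, ← map_div_expMeasure hr, ← map_affine_uniformIcc h]
  have hG3 : Measurable fun p : ℝ × ℝ => ∫⁻ l, ∫⁻ r, F (MondrianTree.node t₀ (t₀ + p.1) p.2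
        (fun w => runAt w l a p.2 (t₀ + p.1)) (fun w => runAt w r p.2 b (t₀ + p.1)))
        ∂seedLaw ∂seedLaw := hG2
  have := isProbabilityMeasure_uniformIcc h
  have hmap : IsProbabilityMeasure ((uniformIcc 0 1).map (fun u => a + u * (b - a))) := by
    rw [map_affine_uniformIcc h]; infer_instance
  rw [lintegral_map hG3.lintegral_prod_right' (by fun_prop)]
  have hL : Measurable fun z : ℝ × ℝ => ∫⁻ p, F (fun w => runAt w (glue (z, p)) a b t₀)
      ∂seedLaw.prod seedLaw := (hrun.comp measurable_glue).lintegral_prod_right'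
  rw [lintegral_prod _ hL.aemeasurable]
  refine lintegral_congr fun e => ?_
  have hG4 := hG3.comp (f := fun x => (e / (b - a), x)) (by fun_prop)
  refine Eq.trans ?_ (lintegral_map hG4 (by fun_prop)).symm
  refine lintegral_congr fun u => ?_
  rw [lintegral_prod (fun p => F fun w => runAt w (glue ((e, u), p)) a b t₀)
    ((hrun.comp measurable_glue).comp (f := fun p => ((e, u), p)) (by fun_prop)).aemeasurable]
  simp only [run_glue, Function.comp]

end Mondrian

/-- The Poisson distribution with rate `r ∈ [0, ∞]`, as a distribution on `{0, 1, …, ∞}`; the one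
with infinite rate is concentrated at `∞`. -/
def poissonENat (r : ℝ≥0∞) : Measure ℕ∞ :=
  if r = ∞ then Measure.dirac ⊤ else (poissonMeasure r.toNNReal).map (Nat.cast : ℕ → ℕ∞)

/-- The random set `X` is a Poisson point process with constant intensity `r` on the region
`S ⊆ ℝ` (on the whole line if `S = univ`): it is almost surely a countable subset of `S`, the number
of its points in a Borel set `A ⊆ S` is Poisson distributed with rate `r` times the Lebesgue
measure of `A`, and the numbers of its points in disjoint Borel subsets of `S` are independent. -/
structure IsPoissonPointProcess {Ω : Type*} [MeasurableSpace Ω] (X : Ω → Set ℝ) (S : Set ℝ)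
    (r : ℝ≥0) (P : Measure Ω) : Prop where
  countable : ∀ᵐ ω ∂P, (X ω).Countable
  subset : ∀ᵐ ω ∂P, X ω ⊆ S
  hasLaw_encard : ∀ A : Set ℝ, MeasurableSet A → A ⊆ S →
    HasLaw (fun ω => (X ω ∩ A).encard) (poissonENat (r * volume A)) P
  iIndepFun_encard : ∀ (n : ℕ) (A : Fin n → Set ℝ), (∀ i, MeasurableSet (A i)) →
    (∀ i, A i ⊆ S) → Pairwise (Function.onFun Disjoint A) →
    iIndepFun (fun i ω => (X ω ∩ A i).encard) P

end

/-!
The proof computes the generating functional `E ∏ f(x)`, the product taken over the cuts `x` born by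
time `t`, for measurable `f : ℝ → [0, 1]`. Conditioning on the first cut `(T, x)` of `[a, b]`, it
satisfies, for a run started `s` time units before `t`,
`Φ(a, b, s) = e^{-(b-a)s} + ∫₀ˢ e^{-(b-a)T} ∫ₐᵇ f(x) Φ(a, x, s-T) Φ(x, b, s-T) dx dT`.
The functional `exp (-s ∫ₐᵇ (1 - f))` of the Poisson process solves this equation
(`lintegral_poissonGF`): by additivity of the integral the product `Φ(a, x) Φ(x, b)` does not depend
on `x`, and an elementary integral over `T` remains. A solution with values in `[0, 1]` is unique
(`lintegral_eq_poissonGF`): two solutions differ by at most `1`, and unfolding the equation `n`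
times improves this bound to `(2 (b-a) s)ⁿ / n!`.

Applied to `f = ∏ᵢ 2^{-kᵢ}` on `Aᵢ` for disjoint `Aᵢ`, this gives the joint probability generating
function of the numbers of cuts in the `Aᵢ` at the points `2^{-kᵢ}`, that is, all mixed moments of
the variables `2^{-N(Aᵢ)} ∈ [0, 1]`, with `2^{-∞} = 0`. They agree with those of independent
Poisson variables, and moments determine a measure on a cube (`ext_of_integral_prod_pow`,
by Stone-Weierstrass), so the joint laws agree (`map_cutCount_law`).

The generating functional counts nodes of the tree, whereas a point process counts locations. The
two counts agree almost surely, because a cut lies strictly inside its interval and thus differs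
from all cuts made later in its two halves (`isProper_runAt`, `IsProper.encard_inter`).
-/

/-! ### Almost sure properties of the tree -/

namespace MondrianTree

/-- The almost sure shape of a tree generated on `[a, b]` from start time `t₀`: no cut is
born before `t₀`, all lie strictly inside `[a, b]`, and no two nodes are cut at the same location. -/
structure IsProper (m : MondrianTree) (a b t₀ : ℝ) : Prop where
  le_cutTime : ∀ w, t₀ ≤ m.cutTime w
  cutLocation_mem : ∀ w, m.cutLocation w ∈ Ioo a b
  cutLocation_injective : Function.Injective m.cutLocation

/-- The number of nodes that are cut inside `A` at time `t` or earlier. -/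
noncomputable def cutCount (m : MondrianTree) (t : ℝ) (A : Set ℝ) : ℕ∞ :=
  {w | m.cutTime w ≤ t ∧ m.cutLocation w ∈ A}.encard

lemma measurable_cutTime (w : List Bool) : Measurable fun m : MondrianTree => m.cutTime w := by
  unfold cutTime; fun_prop

lemma measurable_cutLocation (w : List Bool) :
    Measurable fun m : MondrianTree => m.cutLocation w := by
  unfold cutLocation; fun_prop

lemma measurableSet_isProper (a b t₀ : ℝ) :
    MeasurableSet {m : MondrianTree | m.IsProper a b t₀} := by
  have : {m : MondrianTree | m.IsProper a b t₀} =
      (⋂ w, {m | t₀ ≤ m.cutTime w}) ∩ (⋂ w, {m | m.cutLocation w ∈ Ioo a b}) ∩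
        ⋂ (v) (w) (_ : v ≠ w), {m : MondrianTree | m.cutLocation v = m.cutLocation w}ᶜ := by
    ext m
    simp only [mem_ofPred_eq, mem_inter_iff, mem_iInter, mem_compl_iff]
    constructor
    · exact fun h => ⟨⟨h.1, h.2⟩, fun v w hvw h' => hvw (h.3 h')⟩
    · rintro ⟨⟨h1, h2⟩, h3⟩
      exact ⟨h1, h2, fun v w h => by_contra fun hvw => h3 v w hvw h⟩
  rw [this]
  refine ((MeasurableSet.iInter fun w => ?_).inter (MeasurableSet.iInter fun w => ?_)).inter
    (MeasurableSet.iInter fun v => MeasurableSet.iInter fun w => MeasurableSet.iInter fun _ =>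
      (measurableSet_eq_fun (measurable_cutLocation v) (measurable_cutLocation w)).compl)
  · exact measurableSet_le measurable_const (measurable_cutTime w)
  · exact measurable_cutLocation w measurableSet_Ioo

lemma measurable_cutCount (t : ℝ) {A : Set ℝ} (hA : MeasurableSet A) :
    Measurable fun m : MondrianTree => m.cutCount t A := by
  have key : ∀ k : ℕ, MeasurableSet {m : MondrianTree | (k : ℕ∞) ≤ m.cutCount t A} := by
    intro k
    have : {m : MondrianTree | (k : ℕ∞) ≤ m.cutCount t A} =
        ⋃ (F : Finset (List Bool)) (_ : F.card = k), ⋂ w ∈ F,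
          {m : MondrianTree | m.cutTime w ≤ t ∧ m.cutLocation w ∈ A} := by
      ext m
      simp only [mem_ofPred_eq, mem_iUnion, mem_iInter, exists_prop]
      constructor
      · intro h
        obtain ⟨s, hs, hk⟩ := exists_subset_encard_eq h
        have hf : s.Finite := finite_of_encard_eq_coe hk
        refine ⟨hf.toFinset, ?_, fun w hw => hs (by simpa using hw)⟩
        rw [hf.encard_eq_coe_toFinset_card] at hk
        exact_mod_cast hk
      · rintro ⟨F, rfl, hF⟩
        rw [← encard_coe_eq_coe_finsetCard]
        exact encard_le_encard fun w hw => hF w hw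
    rw [this]
    refine MeasurableSet.iUnion fun F => MeasurableSet.iUnion fun _ =>
      F.measurableSet_biInter fun w _ => ?_
    exact (measurableSet_le (measurable_cutTime w) measurable_const).inter
      (measurable_cutLocation w hA)
  have hcoe : ∀ k : ℕ, MeasurableSet ((fun m : MondrianTree => m.cutCount t A) ⁻¹' {(k : ℕ∞)}) := by
    intro k
    convert (key k).diff (key (k + 1)) using 1
    ext m
    simp only [mem_preimage, mem_singleton_iff, mem_sdiff, mem_ofPred_eq, Nat.cast_add, Nat.cast_one]
    rw [ENat.add_one_le_iff (by simp), not_lt, and_comm, le_antisymm_iff]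
  refine measurable_to_countable' fun k => ?_
  induction k using ENat.recTopCoe with
  | top =>
    convert MeasurableSet.iInter key using 1
    ext m
    simp [ENat.eq_top_iff_forall_ge]
  | coe k => exact hcoe k

/-- Counting cut locations is the same as counting nodes, as no location occurs twice. -/
lemma IsProper.encard_inter {m : MondrianTree} {a b t₀ : ℝ} (h : m.IsProper a b t₀) (t : ℝ)
    (A : Set ℝ) : (m.cutLocations t ∩ A).encard = m.cutCount t A := by
  have : m.cutLocations t ∩ A =
      m.cutLocation '' {w | m.cutTime w ≤ t ∧ m.cutLocation w ∈ A} := by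
    ext x
    simp only [cutLocations, mem_inter_iff, mem_ofPred_eq, mem_image]
    constructor
    · rintro ⟨⟨w, hw, rfl⟩, hA⟩; exact ⟨w, ⟨hw, hA⟩, rfl⟩
    · rintro ⟨w, ⟨hw, hA⟩, rfl⟩; exact ⟨⟨w, hw, rfl⟩, hA⟩
  rw [this, h.cutLocation_injective.encard_image, cutCount]

lemma IsProper.cutCount_eq_zero {m : MondrianTree} {a b t₀ t : ℝ} (h : m.IsProper a b t₀)
    (ht : t < t₀) (A : Set ℝ) : m.cutCount t A = 0 := by
  rw [cutCount, encard_eq_zero, eq_empty_iff_forall_notMem]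
  exact fun w hw => (ht.trans_le (h.le_cutTime w)).not_ge hw.1

open Classical in
lemma cutCount_node (tb tc x : ℝ) (l r : MondrianTree) (t : ℝ) (A : Set ℝ) :
    (node tb tc x l r).cutCount t A =
      (if tc ≤ t ∧ x ∈ A then 1 else 0) + l.cutCount t A + r.cutCount t A := by
  set S := fun m : MondrianTree => {w | m.cutTime w ≤ t ∧ m.cutLocation w ∈ A}
  have hS : S (node tb tc x l r) =
      (({w | w = [] ∧ tc ≤ t ∧ x ∈ A} : Set (List Bool)) ∪ List.cons false '' S l) ∪
        List.cons true '' S r := by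
    ext w
    rcases w with _ | ⟨_ | _, w⟩ <;> simp [S, node, cutTime, cutLocation]
  change (S _).encard = _ + (S l).encard + (S r).encard
  rw [hS, encard_union_eq, encard_union_eq, (List.cons_injective).encard_image,
    (List.cons_injective).encard_image]
  · congr 2
    split_ifs with h <;> simp [h]
  · rw [disjoint_left]; rintro w ⟨rfl, -⟩; simp
  · rw [disjoint_left]; rintro w (⟨rfl, -⟩ | ⟨w, -, rfl⟩) <;> simp

end MondrianTree

namespace Mondrian

/-- For draws `e ≥ 0` and `u ∈ (0, 1)` the intervals to the left and to the right of a cut have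
disjoint interiors, so that every cut avoids all others: the run is proper for all such draws. -/
lemma isProper_runAt {s : List Bool → ℝ × ℝ} (hs : ∀ w, 0 ≤ (s w).1 ∧ (s w).2 ∈ Ioo 0 1)
    {a b : ℝ} (h : a < b) (t₀ : ℝ) :
    MondrianTree.IsProper (fun w => runAt w s a b t₀) a b t₀ := by
  have hx : ∀ {s : List Bool → ℝ × ℝ}, (∀ w, 0 ≤ (s w).1 ∧ (s w).2 ∈ Ioo 0 1) →
      ∀ {a b : ℝ}, a < b → a + (s []).2 * (b - a) ∈ Ioo a b := by
    intro s hs a b h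
    have h1 := (hs []).2.1
    have h2 := (hs []).2.2
    constructor <;> nlinarith
  have hT : ∀ {s : List Bool → ℝ × ℝ}, (∀ w, 0 ≤ (s w).1 ∧ (s w).2 ∈ Ioo 0 1) →
      ∀ {a b : ℝ}, a < b → 0 ≤ (s []).1 / (b - a) :=
    fun hs _ _ h => div_nonneg (hs []).1 (sub_pos.2 h).le
  have hloc : ∀ (w : List Bool) (s : List Bool → ℝ × ℝ),
      (∀ w, 0 ≤ (s w).1 ∧ (s w).2 ∈ Ioo 0 1) → ∀ a b t₀ : ℝ, a < b →
      t₀ ≤ (runAt w s a b t₀).2.1 ∧ (runAt w s a b t₀).2.2 ∈ Ioo a b := by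
    intro w
    induction w with
    | nil => intro s hs a b t₀ h; exact ⟨by simpa [runAt] using hT hs h, hx hs h⟩
    | cons c w ih =>
      intro s hs a b t₀ h
      have h' := hx hs h
      have h'' := hT hs h
      cases c
      · obtain ⟨i1, i2⟩ := ih (fun v => s (false :: v)) (fun v => hs _) a (a + (s []).2 * (b - a))
          (t₀ + (s []).1 / (b - a)) h'.1
        exact ⟨by simp only [runAt]; linarith, i2.1, i2.2.trans h'.2⟩
      · obtain ⟨i1, i2⟩ := ih (fun v => s (true :: v)) (fun v => hs _) (a + (s []).2 * (b - a)) b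
          (t₀ + (s []).1 / (b - a)) h'.2
        exact ⟨by simp only [runAt]; linarith, h'.1.trans i2.1, i2.2⟩
  have hinj : ∀ (v w : List Bool) (s : List Bool → ℝ × ℝ),
      (∀ w, 0 ≤ (s w).1 ∧ (s w).2 ∈ Ioo 0 1) → ∀ a b t₀ : ℝ, a < b →
      (runAt v s a b t₀).2.2 = (runAt w s a b t₀).2.2 → v = w := by
    intro v
    induction v with
    | nil =>
      rintro (_ | ⟨_ | _, w⟩) s hs a b t₀ h he
      · rfl
      · exact absurd he
          (hloc w (fun v => s (false :: v)) (fun v => hs _) _ _ _ (hx hs h).1).2.2.ne'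
      · exact absurd he
          (hloc w (fun v => s (true :: v)) (fun v => hs _) _ _ _ (hx hs h).2).2.1.ne
    | cons c v ih =>
      rintro (_ | ⟨d, w⟩) s hs a b t₀ h he
      · cases c
        · exact absurd he
            (hloc v (fun v => s (false :: v)) (fun v => hs _) _ _ _ (hx hs h).1).2.2.ne
        · exact absurd he
            (hloc v (fun v => s (true :: v)) (fun v => hs _) _ _ _ (hx hs h).2).2.1.ne'
      · have hl := fun w t => hloc w (fun v => s (false :: v)) (fun v => hs _) _ _ t (hx hs h).1
        have hr := fun w t => hloc w (fun v => s (true :: v)) (fun v => hs _) _ _ t (hx hs h).2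
        cases c <;> cases d
        · rw [ih w _ (fun v => hs _) _ _ _ (hx hs h).1 he]
        · exact absurd he ((hl v _).2.2.trans (hr w _).2.1).ne
        · exact absurd he ((hl w _).2.2.trans (hr v _).2.1).ne'
        · rw [ih w _ (fun v => hs _) _ _ _ (hx hs h).2 he]
  exact ⟨fun w => (hloc w s hs a b t₀ h).1, fun w => (hloc w s hs a b t₀ h).2,
    fun v w => hinj v w s hs a b t₀ h⟩

lemma ae_nonneg_expMeasure (r : ℝ) : ∀ᵐ e ∂expMeasure r, 0 ≤ e := by
  have h : {e : ℝ | 0 ≤ e}ᶜ = Iio 0 := by ext; simp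
  rw [ae_iff, ← compl_ofPred, h, expMeasure, gammaMeasure, withDensity_apply _ measurableSet_Iio]
  exact lintegral_gammaPDF_of_nonpos le_rfl

lemma ae_mem_Ioo_uniformIcc (a b : ℝ) : ∀ᵐ u ∂uniformIcc a b, u ∈ Ioo a b := by
  have h : uniformIcc a b ≪ volume.restrict (Icc a b) := by
    unfold uniformIcc ProbabilityTheory.cond
    exact Measure.smul_absolutelyContinuous
  refine h.ae_le ?_
  rw [← restrict_Ioo_eq_restrict_Icc]
  exact ae_restrict_mem measurableSet_Ioo

lemma ae_seedLaw : ∀ᵐ s ∂seedLaw, ∀ w, 0 ≤ (s w).1 ∧ (s w).2 ∈ Ioo 0 1 := by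
  have := isProbabilityMeasure_expMeasure (r := 1) one_pos
  have := isProbabilityMeasure_uniformIcc (a := 0) (b := 1) one_pos
  have hd : ∀ᵐ z ∂drawLaw, 0 ≤ z.1 ∧ z.2 ∈ Ioo (0 : ℝ) 1 :=
    (Measure.quasiMeasurePreserving_fst.ae (ae_nonneg_expMeasure 1)).and
      (Measure.quasiMeasurePreserving_snd.ae (ae_mem_Ioo_uniformIcc 0 1))
  rw [ae_all_iff]
  intro w
  exact (measurePreserving_eval_infinitePi (fun _ : List Bool => drawLaw)
    w).quasiMeasurePreserving.ae hd

lemma ae_isProper {a b : ℝ} (h : a < b) (t₀ : ℝ) :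
    ∀ᵐ m ∂startedAt a b t₀, m.IsProper a b t₀ := by
  have hm : Measurable fun s w => runAt w s a b t₀ :=
    measurable_run.comp (f := fun s => (s, a, b, t₀)) (by fun_prop)
  refine (ae_map_iff hm.aemeasurable (MondrianTree.measurableSet_isProper a b t₀)).2 ?_
  filter_upwards [ae_seedLaw] with s hs using isProper_runAt hs h t₀

end Mondrian

/-! ### Integrals against the exponential and the uniform distribution -/

namespace Mondrian

lemma lintegral_expMeasure_ite {r s : ℝ} (hr : 0 < r) (hs : 0 ≤ s) {g : ℝ → ℝ}
    (hg : Continuous g) (hg0 : ∀ T ∈ Ioc 0 s, 0 ≤ g T) (c : ℝ≥0∞) :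
    ∫⁻ T, (if T ≤ s then ENNReal.ofReal (g T) else c) ∂expMeasure r =
      ENNReal.ofReal (∫ T in (0)..s, r * Real.exp (-(r * T)) * g T) +
        c * ENNReal.ofReal (Real.exp (-(r * s))) := by
  have := isProbabilityMeasure_expMeasure hr
  rw [← lintegral_add_compl _ (measurableSet_Iic (a := s))]
  congr 1
  · rw [setLIntegral_congr_fun (f := fun T => if T ≤ s then ENNReal.ofReal (g T) else c)
      measurableSet_Iic (fun T hT => if_pos hT), expMeasure, gammaMeasure,
      setLIntegral_withDensity_eq_setLIntegral_mul _ (f := gammaPDF 1 r)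
        (measurable_exponentialPDFReal r).ennreal_ofReal (by fun_prop) measurableSet_Iic]
    have h1 : ∫⁻ T in Iic s, (gammaPDF 1 r * fun T => ENNReal.ofReal (g T)) T =
        ∫⁻ T in Icc 0 s, (gammaPDF 1 r * fun T => ENNReal.ofReal (g T)) T := by
      rw [lintegral_Iic_eq_lintegral_Iio_add_Icc _ hs, setLIntegral_congr_fun measurableSet_Iio
        (g := fun _ => 0) (fun T hT => by simp [gammaPDF_of_neg (mem_Iio.1 hT)])]
      simp
    rw [h1, intervalIntegral.integral_of_le hs, ofReal_integral_eq_lintegral_ofReal]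
    · rw [restrict_Ioc_eq_restrict_Icc]
      refine setLIntegral_congr_fun measurableSet_Icc fun T hT => ?_
      have := exponentialPDF_of_nonneg (r := r) hT.1
      rw [exponentialPDF] at this
      rw [ENNReal.ofReal_mul (by positivity), ← this]
      rfl
    · exact (Continuous.integrableOn_Icc (by fun_prop)).mono_set Ioc_subset_Icc_self
    · filter_upwards [ae_restrict_mem measurableSet_Ioc] with T hT
      exact mul_nonneg (by positivity) (hg0 T hT)
  · rw [compl_Iic, setLIntegral_congr_fun (f := fun T => if T ≤ s then ENNReal.ofReal (g T) else c)
      measurableSet_Ioi (fun T hT => if_neg (not_le.2 hT)), setLIntegral_const, ← compl_Iic,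
      prob_compl_eq_one_sub measurableSet_Iic, ← ofReal_cdf, cdf_expMeasure_eq hr, if_pos hs,
      ← ENNReal.ofReal_one, ← ENNReal.ofReal_sub]
    · simp
    · simp; positivity

lemma lintegral_uniformIcc_ofReal {a b : ℝ} (h : a < b) {f : ℝ → ℝ} (hf : Measurable f)
    (hf01 : ∀ x, f x ∈ Icc 0 1) :
    ∫⁻ x, ENNReal.ofReal (f x) ∂uniformIcc a b =
      ENNReal.ofReal ((∫ x in a..b, f x) / (b - a)) := by
  have hr := sub_pos.2 h
  have hfi : IntegrableOn f (Icc a b) := by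
    refine Measure.integrableOn_of_bounded (M := 1) (by simp) hf.aestronglyMeasurable ?_
    exact Filter.Eventually.of_forall fun x => by
      rw [Real.norm_of_nonneg (hf01 x).1]; exact (hf01 x).2
  rw [uniformIcc, ProbabilityTheory.cond, lintegral_smul_measure, intervalIntegral.integral_of_le
    h.le, ← integral_Icc_eq_integral_Ioc, ENNReal.ofReal_div_of_pos hr,
    ofReal_integral_eq_lintegral_ofReal hfi (Filter.Eventually.of_forall fun x => (hf01 x).1),
    Real.volume_Icc, smul_eq_mul, ENNReal.div_eq_inv_mul]

/-! ### The generating functional -/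

lemma mul_le_mul_add_add {x₁ x₂ y₁ y₂ e₁ e₂ : ℝ≥0∞} (hx₂ : x₂ ≤ 1) (hy₁ : y₁ ≤ 1)
    (h₁ : x₁ ≤ y₁ + e₁) (h₂ : x₂ ≤ y₂ + e₂) : x₁ * x₂ ≤ y₁ * y₂ + (e₁ + e₂) :=
  calc x₁ * x₂ ≤ (y₁ + e₁) * x₂ := by gcongr
    _ = y₁ * x₂ + e₁ * x₂ := add_mul ..
    _ ≤ y₁ * (y₂ + e₂) + e₁ * 1 := by gcongr
    _ = y₁ * y₂ + y₁ * e₂ + e₁ := by rw [mul_add, mul_one]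
    _ ≤ y₁ * y₂ + 1 * e₂ + e₁ := by gcongr
    _ = y₁ * y₂ + (e₁ + e₂) := by rw [one_mul, add_assoc, add_comm e₂]

/-- The value at `f` of the generating functional of a Poisson process with constant intensity `s`
on `[a, b]`, where a negative `s` counts as zero. -/
noncomputable def poissonGF (f : ℝ → ℝ) (a b s : ℝ) : ℝ :=
  Real.exp (-(max s 0 * ∫ x in a..b, (1 - f x)))

lemma intervalIntegrable_of_mem_Icc {f : ℝ → ℝ} (hf : Measurable f)
    (hf01 : ∀ x, f x ∈ Icc 0 1) (a b : ℝ) : IntervalIntegrable f volume a b := by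
  rw [intervalIntegrable_iff]
  refine Measure.integrableOn_of_bounded (M := 1) (by simp [uIoc]) hf.aestronglyMeasurable ?_
  exact Filter.Eventually.of_forall fun x => by
    rw [Real.norm_of_nonneg (hf01 x).1]; exact (hf01 x).2

lemma poissonGF_of_nonneg (f : ℝ → ℝ) (a b : ℝ) {s : ℝ} (hs : 0 ≤ s) :
    poissonGF f a b s = Real.exp (-(s * ∫ x in a..b, (1 - f x))) := by
  rw [poissonGF, max_eq_left hs]

lemma poissonGF_of_neg (f : ℝ → ℝ) (a b : ℝ) {s : ℝ} (hs : s < 0) :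
    poissonGF f a b s = 1 := by
  rw [poissonGF, max_eq_right hs.le]; simp

lemma poissonGF_nonneg (f : ℝ → ℝ) (a b s : ℝ) : 0 ≤ poissonGF f a b s := (Real.exp_pos _).le

lemma poissonGF_le_one {f : ℝ → ℝ} (hf01 : ∀ x, f x ∈ Icc 0 1) {a b : ℝ} (h : a ≤ b) (s : ℝ) :
    poissonGF f a b s ≤ 1 := by
  have : 0 ≤ ∫ x in a..b, (1 - f x) :=
    intervalIntegral.integral_nonneg h fun x _ => sub_nonneg.2 (hf01 x).2
  rw [poissonGF, Real.exp_le_one_iff, neg_nonpos]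
  positivity

lemma poissonGF_mul_poissonGF {f : ℝ → ℝ} (hf : Measurable f) (hf01 : ∀ x, f x ∈ Icc 0 1)
    (a x b s : ℝ) : poissonGF f a x s * poissonGF f x b s = poissonGF f a b s := by
  have hi : ∀ c d, IntervalIntegrable (fun x => 1 - f x) volume c d := fun c d =>
    intervalIntegrable_const.sub (intervalIntegrable_of_mem_Icc hf hf01 c d)
  rw [poissonGF, poissonGF, poissonGF, ← Real.exp_add,
    ← intervalIntegral.integral_add_adjacent_intervals (hi a x) (hi x b)]
  congr 1; ring

/-- The factor by which a cut at time `tc` and location `x` enters the generating functional of the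
cuts born by time `t`. -/
noncomputable def cutWeight (f : ℝ → ℝ) (t tc x : ℝ) : ℝ≥0∞ :=
  if tc ≤ t then ENNReal.ofReal (f x) else 1

lemma cutWeight_le_one {f : ℝ → ℝ} (hf01 : ∀ x, f x ∈ Icc 0 1) (t tc x : ℝ) :
    cutWeight f t tc x ≤ 1 := by
  unfold cutWeight; split_ifs
  · simpa using (hf01 x).2
  · rfl

/-- The Poisson generating functional solves the equation that the recursive procedure imposes on
the generating functional of the cuts: condition on the first cut of `[a, b]`. -/
lemma lintegral_poissonGF {f : ℝ → ℝ} (hf : Measurable f) (hf01 : ∀ x, f x ∈ Icc 0 1)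
    {a b t₀ t : ℝ} (h : a < b) (ht : t₀ ≤ t) :
    ∫⁻ T, ∫⁻ x, cutWeight f t (t₀ + T) x * ENNReal.ofReal (poissonGF f a x (t - (t₀ + T))) *
        ENNReal.ofReal (poissonGF f x b (t - (t₀ + T))) ∂uniformIcc a b ∂expMeasure (b - a) =
      ENNReal.ofReal (poissonGF f a b (t - t₀)) := by
  have hr := sub_pos.2 h
  have := isProbabilityMeasure_uniformIcc h
  set H := ∫ x in a..b, (1 - f x) with hH
  set F := ∫ x in a..b, f x with hF
  have hHF : H = b - a - F := by
    rw [hH, intervalIntegral.integral_sub intervalIntegrable_const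
      (intervalIntegrable_of_mem_Icc hf hf01 a b)]
    simp [hF]
  have hF0 : 0 ≤ F := intervalIntegral.integral_nonneg h.le fun x _ => (hf01 x).1
  have hinner : ∀ T, ∫⁻ x, cutWeight f t (t₀ + T) x *
        ENNReal.ofReal (poissonGF f a x (t - (t₀ + T))) *
        ENNReal.ofReal (poissonGF f x b (t - (t₀ + T))) ∂uniformIcc a b =
      if T ≤ t - t₀ then ENNReal.ofReal (Real.exp (-((t - t₀ - T) * H)) * (F / (b - a)))
        else 1 := by
    intro T
    have : ∀ x, cutWeight f t (t₀ + T) x * ENNReal.ofReal (poissonGF f a x (t - (t₀ + T))) *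
        ENNReal.ofReal (poissonGF f x b (t - (t₀ + T))) =
        cutWeight f t (t₀ + T) x * ENNReal.ofReal (poissonGF f a b (t - (t₀ + T))) := by
      intro x
      rw [mul_assoc, ← ENNReal.ofReal_mul (poissonGF_nonneg ..), poissonGF_mul_poissonGF hf hf01]
    rw [lintegral_congr this]
    simp only [cutWeight]
    split_ifs with h1 h2 h2
    · rw [lintegral_mul_const _ (by fun_prop), lintegral_uniformIcc_ofReal h hf hf01,
        poissonGF_of_nonneg _ _ _ (by linarith), mul_comm, ← ENNReal.ofReal_mul (Real.exp_pos _).le,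
        ← sub_sub]
    · exact absurd (by linarith) h2
    · exact absurd (by linarith) h1
    · rw [poissonGF_of_neg _ _ _ (by linarith)]; simp
  simp only [hinner]
  rw [lintegral_expMeasure_ite hr (sub_nonneg.2 ht)
      (g := fun T => Real.exp (-((t - t₀ - T) * H)) * (F / (b - a))) (by fun_prop)
      (fun T _ => by positivity), poissonGF_of_nonneg _ _ _ (sub_nonneg.2 ht), ← hH]
  set s := t - t₀ with hs
  have hs0 : 0 ≤ s := sub_nonneg.2 ht
  have hint : ∫ T in (0)..s, (b - a) * Real.exp (-((b - a) * T)) *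
      (Real.exp (-((s - T) * H)) * (F / (b - a))) =
      Real.exp (-(s * H)) - Real.exp (-((b - a) * s)) := by
    have hderiv : ∀ T ∈ uIcc 0 s, HasDerivAt (fun T => -Real.exp (-(T * F + s * H)))
        ((b - a) * Real.exp (-((b - a) * T)) * (Real.exp (-((s - T) * H)) * (F / (b - a)))) T := by
      intro T _
      have h1 : HasDerivAt (fun T : ℝ => -(T * F + s * H)) (-(1 * F)) T :=
        (((hasDerivAt_id T).mul_const F).add_const _).neg
      refine h1.exp.neg.congr_deriv ?_
      have : Real.exp (-(T * F + s * H)) =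
          Real.exp (-((b - a) * T)) * Real.exp (-((s - T) * H)) := by
        rw [← Real.exp_add, hHF]; congr 1; ring
      rw [this]; field_simp
    rw [intervalIntegral.integral_eq_sub_of_hasDerivAt hderiv
      (Continuous.intervalIntegrable (by fun_prop) _ _)]
    have : s * F + s * H = (b - a) * s := by rw [hHF]; ring
    rw [this]; simp; ring
  rw [hint, one_mul, ← ENNReal.ofReal_add _ (Real.exp_pos _).le]
  · congr 1; ring
  · rw [sub_nonneg, Real.exp_le_exp, hHF]; nlinarith

/-- The bound on the distance of two solutions of the recursion after unfolding it `n` times. -/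
noncomputable def recursionError (n : ℕ) (r s : ℝ) : ℝ :=
  (2 * r * s) ^ n / n.factorial

lemma lintegral_recursionError (n : ℕ) {r s : ℝ} (hr : 0 < r) (hs : 0 ≤ s) :
    ∫⁻ T, (if T ≤ s then ENNReal.ofReal (2 * recursionError n r (s - T)) else 0) ∂expMeasure r ≤
      ENNReal.ofReal (recursionError (n + 1) r s) := by
  have hc : Continuous fun T => 2 * recursionError n r (s - T) := by
    unfold recursionError; fun_prop
  have h0 : ∀ T ∈ Icc 0 s, 0 ≤ 2 * recursionError n r (s - T) := fun T hT => by
    have := sub_nonneg.2 hT.2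
    unfold recursionError; positivity
  rw [lintegral_expMeasure_ite hr hs hc fun T hT => h0 T (Ioc_subset_Icc_self hT)]
  rw [zero_mul, add_zero]
  refine ENNReal.ofReal_le_ofReal ?_
  calc ∫ T in (0)..s, r * Real.exp (-(r * T)) * (2 * recursionError n r (s - T))
      ≤ ∫ T in (0)..s, r * (2 * recursionError n r (s - T)) := by
        refine intervalIntegral.integral_mono_on hs (Continuous.intervalIntegrable (by fun_prop) _ _)
          (Continuous.intervalIntegrable (by fun_prop) _ _) fun T hT => ?_
        have := h0 T hT
        have : Real.exp (-(r * T)) ≤ 1 := by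
          rw [Real.exp_le_one_iff, neg_nonpos]; exact mul_nonneg hr.le hT.1
        have : r * Real.exp (-(r * T)) ≤ r := mul_le_of_le_one_right hr.le this
        gcongr
    _ = ∫ T in (0)..s, (2 * r) ^ (n + 1) / n.factorial * (s - T) ^ n := by
        congr 1; ext T; unfold recursionError; rw [mul_pow, pow_succ]; ring
    _ = recursionError (n + 1) r s := by
        rw [intervalIntegral.integral_const_mul,
          intervalIntegral.integral_comp_sub_left (fun T => T ^ n) s, integral_pow, recursionError,
          Nat.factorial_succ]
        push_cast
        simp only [sub_self, sub_zero, zero_pow (Nat.succ_ne_zero n), mul_pow _ s]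
        field_simp

/-- Uniqueness in the recursion. A functional `W` of the tree that is multiplicative over the root
and the two subtrees has a mean that solves the same equation as the Poisson generating functional;
unfolding the equation `n` times bounds the difference by `recursionError n`, which tends to `0`. -/
theorem lintegral_eq_poissonGF {f : ℝ → ℝ} (hf : Measurable f) (hf01 : ∀ x, f x ∈ Icc 0 1)
    {t : ℝ} {W : MondrianTree → ℝ≥0∞} (hW : Measurable W) (hW1 : ∀ m, W m ≤ 1)
    (hnode : ∀ tb tc x l r, W (MondrianTree.node tb tc x l r) = cutWeight f t tc x * W l * W r)
    (hlate : ∀ a b t₀, a < b → t < t₀ → ∀ᵐ m ∂startedAt a b t₀, W m = 1)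
    {a b t₀ : ℝ} (h : a < b) (ht : t₀ ≤ t) :
    ∫⁻ m, W m ∂startedAt a b t₀ = ENNReal.ofReal (poissonGF f a b (t - t₀)) := by
  set I : ℝ → ℝ → ℝ → ℝ≥0∞ := fun a b t₀ => ∫⁻ m, W m ∂startedAt a b t₀ with hI
  set G : ℝ → ℝ → ℝ → ℝ≥0∞ := fun a b t₀ => ENNReal.ofReal (poissonGF f a b (t - t₀)) with hG
  have hI1 : ∀ a b t₀, I a b t₀ ≤ 1 := fun a b t₀ =>
    (lintegral_mono hW1).trans (by simp)
  have hG1 : ∀ {a b} t₀, a < b → G a b t₀ ≤ 1 := fun t₀ h =>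
    ENNReal.ofReal_le_one.2 (poissonGF_le_one hf01 h.le _)
  have hIlate : ∀ {a b t₀}, a < b → t < t₀ → I a b t₀ = 1 := fun {a b t₀} h ht => by
    rw [hI]; simp only; rw [lintegral_congr_ae (hlate a b t₀ h ht)]; simp
  have hGlate : ∀ {a b t₀}, t < t₀ → G a b t₀ = 1 := fun {a b t₀} ht => by
    rw [hG]; simp only; rw [poissonGF_of_neg _ _ _ (sub_neg.2 ht), ENNReal.ofReal_one]
  have hIrec : ∀ {a b} t₀, a < b → I a b t₀ = ∫⁻ T, ∫⁻ x, cutWeight f t (t₀ + T) x *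
      I a x (t₀ + T) * I x b (t₀ + T) ∂uniformIcc a b ∂expMeasure (b - a) := by
    intro a b t₀ h
    rw [hI]; simp only
    rw [lintegral_startedAt h t₀ hW]
    refine lintegral_congr fun T => lintegral_congr fun x => ?_
    simp only [hnode]
    simp_rw [lintegral_const_mul _ hW]
    rw [lintegral_mul_const _ (by fun_prop), lintegral_const_mul _ hW]
  have hGrec : ∀ {a b t₀}, a < b → t₀ ≤ t → G a b t₀ = ∫⁻ T, ∫⁻ x, cutWeight f t (t₀ + T) x *
      G a x (t₀ + T) * G x b (t₀ + T) ∂uniformIcc a b ∂expMeasure (b - a) := fun h ht =>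
    (lintegral_poissonGF hf hf01 h ht).symm
  -- One unfolding turns a bound between two solutions on subintervals into one on `[a, b]`.
  have hstep : ∀ (n : ℕ) (U V : ℝ → ℝ → ℝ → ℝ≥0∞), (∀ a b t₀, a < b → U a b t₀ ≤ 1) →
      (∀ a b t₀, a < b → V a b t₀ ≤ 1) → (∀ a b t₀, a < b → t < t₀ → U a b t₀ = 1) →
      (∀ a b t₀, a < b → t < t₀ → V a b t₀ = 1) →
      (∀ a b t₀, a < b → t₀ ≤ t →
        U a b t₀ ≤ V a b t₀ + ENNReal.ofReal (recursionError n (b - a) (t - t₀))) →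
      ∀ a b t₀, a < b → t₀ ≤ t →
        ∫⁻ T, ∫⁻ x, cutWeight f t (t₀ + T) x * U a x (t₀ + T) * U x b (t₀ + T)
            ∂uniformIcc a b ∂expMeasure (b - a) ≤
          ∫⁻ T, ∫⁻ x, cutWeight f t (t₀ + T) x * V a x (t₀ + T) * V x b (t₀ + T)
            ∂uniformIcc a b ∂expMeasure (b - a) +
          ENNReal.ofReal (recursionError (n + 1) (b - a) (t - t₀)) := by
    intro n U V hU1 hV1 hUl hVl hUV a b t₀ h ht
    have := isProbabilityMeasure_uniformIcc h
    have hr := sub_pos.2 h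
    set E : ℝ → ℝ≥0∞ := fun T => if T ≤ t - t₀ then
      ENNReal.ofReal (2 * recursionError n (b - a) (t - t₀ - T)) else 0 with hE
    have hEm : Measurable E := by
      refine Measurable.ite measurableSet_Iic ?_ measurable_const
      unfold recursionError; fun_prop
    refine le_trans ?_ (add_le_add_right (lintegral_recursionError n hr (sub_nonneg.2 ht)) _)
    rw [← lintegral_add_right _ hEm]
    refine lintegral_mono fun T => ?_
    have : E T = ∫⁻ _, E T ∂uniformIcc a b := by simp
    simp only
    change _ ≤ _ + E T
    rw [this, ← lintegral_add_right _ measurable_const]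
    refine lintegral_mono_ae ?_
    filter_upwards [ae_mem_Ioo_uniformIcc a b] with x hx
    have key : U a x (t₀ + T) * U x b (t₀ + T) ≤ V a x (t₀ + T) * V x b (t₀ + T) + E T := by
      by_cases hT : T ≤ t - t₀
      · have hT' : t₀ + T ≤ t := by linarith
        refine (mul_le_mul_add_add (hU1 _ _ _ hx.2) (hV1 _ _ _ hx.1) (hUV _ _ _ hx.1 hT')
          (hUV _ _ _ hx.2 hT')).trans (add_le_add_right ?_ _)
        have hs : 0 ≤ t - t₀ - T := sub_nonneg.2 hT
        have hmono : ∀ r ∈ Icc 0 (b - a), recursionError n r (t - t₀ - T) ≤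
            recursionError n (b - a) (t - t₀ - T) := by
          intro r hr
          have := hr.1
          unfold recursionError
          gcongr
          exact hr.2
        have e : E T = ENNReal.ofReal (2 * recursionError n (b - a) (t - t₀ - T)) := if_pos hT
        rw [e, two_mul, ← sub_sub, ENNReal.ofReal_add]
        · exact add_le_add
            (ENNReal.ofReal_le_ofReal (hmono _ ⟨by linarith [hx.1], by linarith [hx.2]⟩))
            (ENNReal.ofReal_le_ofReal (hmono _ ⟨by linarith [hx.2], by linarith [hx.1]⟩))
        all_goals unfold recursionError; positivity
      -- After time `t` both solutions equal `1`, so that only `T ≤ t - t₀` contributes an error.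
      · have hT' : t < t₀ + T := by linarith
        rw [hUl _ _ _ hx.1 hT', hUl _ _ _ hx.2 hT', hVl _ _ _ hx.1 hT', hVl _ _ _ hx.2 hT']
        exact le_self_add
    calc _ = cutWeight f t (t₀ + T) x * (U a x (t₀ + T) * U x b (t₀ + T)) := mul_assoc ..
      _ ≤ cutWeight f t (t₀ + T) x * (V a x (t₀ + T) * V x b (t₀ + T) + E T) := by gcongr
      _ ≤ _ := by
        rw [mul_add, ← mul_assoc]
        gcongr
        exact mul_le_of_le_one_left' (cutWeight_le_one hf01 _ _ _)
  have hbound : ∀ n a b t₀, a < b → t₀ ≤ t →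
      I a b t₀ ≤ G a b t₀ + ENNReal.ofReal (recursionError n (b - a) (t - t₀)) ∧
      G a b t₀ ≤ I a b t₀ + ENNReal.ofReal (recursionError n (b - a) (t - t₀)) := by
    intro n
    induction n with
    | zero =>
      intro a b t₀ h ht
      simp only [recursionError, pow_zero, Nat.factorial_zero, Nat.cast_one, div_one,
        ENNReal.ofReal_one]
      exact ⟨(hI1 _ _ _).trans le_add_self, (hG1 _ h).trans le_add_self⟩
    | succ n ih =>
      intro a b t₀ h ht
      rw [hIrec t₀ h, hGrec h ht]
      exact ⟨hstep n I G (fun _ _ _ _ => hI1 _ _ _) (fun _ _ _ h => hG1 _ h)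
          (fun _ _ _ h ht => hIlate h ht) (fun _ _ _ _ ht => hGlate ht)
          (fun a b t₀ h ht => (ih a b t₀ h ht).1) a b t₀ h ht,
        hstep n G I (fun _ _ _ h => hG1 _ h) (fun _ _ _ _ => hI1 _ _ _)
          (fun _ _ _ _ ht => hGlate ht) (fun _ _ _ h ht => hIlate h ht)
          (fun a b t₀ h ht => (ih a b t₀ h ht).2) a b t₀ h ht⟩
  have hlim : ∀ c : ℝ≥0∞, Filter.Tendsto
      (fun n => c + ENNReal.ofReal (recursionError n (b - a) (t - t₀))) Filter.atTop (nhds c) := by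
    intro c
    have := ENNReal.tendsto_ofReal
      (FloorSemiring.tendsto_pow_div_factorial_atTop (2 * (b - a) * (t - t₀)))
    simpa [recursionError] using this.const_add c
  exact le_antisymm (ge_of_tendsto' (hlim _) fun n => (hbound n a b t₀ h ht).1)
    (ge_of_tendsto' (hlim _) fun n => (hbound n a b t₀ h ht).2)

end Mondrian

/-! ### Probability generating functions on the extended natural numbers -/

/-- The point `2⁻ᴺ` of the unit interval, with `2⁻ᴺ = 0` for `N = ∞`. Its powers are the values at
`2⁻ᵏ` of the monomials that enter the probability generating function of `N`. -/
noncomputable def halfPow (N : ℕ∞) : unitInterval :=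
  if N = ⊤ then 0 else ⟨(1 / 2) ^ N.toNat, by positivity, pow_le_one₀ (by norm_num) (by norm_num)⟩

lemma halfPow_top : halfPow ⊤ = 0 := if_pos rfl

lemma coe_halfPow_coe (N : ℕ) : (halfPow N : ℝ) = (1 / 2) ^ N := by simp [halfPow]

lemma coe_halfPow_add (M N : ℕ∞) : (halfPow (M + N) : ℝ) = halfPow M * halfPow N := by
  induction M using ENat.recTopCoe with
  | top => simp [halfPow_top]
  | coe M =>
    induction N using ENat.recTopCoe with
    | top => simp [halfPow_top]
    | coe N => rw [← Nat.cast_add, coe_halfPow_coe, coe_halfPow_coe, coe_halfPow_coe, pow_add]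

lemma halfPow_injective : Function.Injective halfPow := by
  have h0 : ∀ N : ℕ, (halfPow N : ℝ) ≠ halfPow ⊤ := fun N => by
    rw [coe_halfPow_coe, halfPow_top]; simp
  intro M N h
  replace h := congrArg ((↑) : unitInterval → ℝ) h
  induction M using ENat.recTopCoe with
  | top =>
    induction N using ENat.recTopCoe with
    | top => rfl
    | coe N => exact absurd h.symm (h0 N)
  | coe M =>
    induction N using ENat.recTopCoe with
    | top => exact absurd h (h0 M)
    | coe N =>
      rw [coe_halfPow_coe, coe_halfPow_coe] at h
      rw [pow_right_injective₀ (by norm_num) (by norm_num) h]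

section Uniqueness

variable {ι : Type*} [Fintype ι]

/-- A finite measure on a cube is determined by its moments, since polynomials are dense. -/
theorem ext_of_integral_prod_pow {μ ν : Measure (ι → unitInterval)} [IsFiniteMeasure μ]
    [IsFiniteMeasure ν]
    (h : ∀ k : ι → ℕ, ∫ y, ∏ i, (y i : ℝ) ^ k i ∂μ = ∫ y, ∏ i, (y i : ℝ) ^ k i ∂ν) : μ = ν := by
  classical
  let c : ι → BoundedContinuousFunction (ι → unitInterval) ℝ := fun i =>
    BoundedContinuousFunction.mkOfCompact ⟨fun y => (y i : ℝ), by fun_prop⟩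
  let A : StarSubalgebra ℝ (BoundedContinuousFunction (ι → unitInterval) ℝ) :=
    { Algebra.adjoin ℝ (range c) with
      star_mem' := fun {g} hg => by
        have : star g = g := by ext; simp
        rwa [this] }
  have hA : ∀ g, g ∈ A ↔ g ∈ Submodule.span ℝ (Submonoid.closure (range c) : Set _) := by
    intro g
    rw [← Algebra.adjoin_eq_span]
    rfl
  refine ext_of_forall_mem_subalgebra_integral_eq_of_polish (𝕜 := ℝ) (A := A) ?_ ?_
  · intro x y hxy
    obtain ⟨i, hi⟩ := Function.ne_iff.1 hxy
    refine ⟨c i, ⟨(c i).toContinuousMap, ?_, rfl⟩, fun he => hi (Subtype.ext he)⟩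
    exact ⟨c i, (hA _).2 (Submodule.subset_span (Submonoid.subset_closure ⟨i, rfl⟩)), rfl⟩
  · intro g hg
    rw [hA] at hg
    induction hg using Submodule.span_induction with
    | mem g hg =>
      have : ∃ k : ι → ℕ, ∀ y, g y = ∏ i, (y i : ℝ) ^ k i := by
        induction hg using Submonoid.closure_induction with
        | mem g hg =>
          obtain ⟨i, rfl⟩ := hg
          refine ⟨Pi.single i 1, fun y => ?_⟩
          rw [Finset.prod_eq_single i]
          · simp [c]
          · intro j _ hj; simp [hj]
          · simp
        | one => exact ⟨0, by simp⟩
        | mul g g' _ _ ih ih' =>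
          obtain ⟨k, hk⟩ := ih
          obtain ⟨k', hk'⟩ := ih'
          exact ⟨k + k', fun y => by
            simp [hk, hk', pow_add, Finset.prod_mul_distrib]⟩
      obtain ⟨k, hk⟩ := this
      simpa only [hk] using h k
    | zero => simp
    | add g g' _ _ ih ih' =>
      simp only [BoundedContinuousFunction.coe_add, Pi.add_apply]
      rw [integral_add (g.integrable _) (g'.integrable _),
        integral_add (g.integrable _) (g'.integrable _), ih, ih']
    | smul r g _ ih =>
      simp only [BoundedContinuousFunction.coe_smul, integral_const_mul, smul_eq_mul, ih]

/-- The law of a finite family of random elements of `ℕ∞` is determined by the joint probability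
generating function at the points `2⁻ᵏ`. -/
theorem ext_of_integral_prod_halfPow_pow {μ ν : Measure (ι → ℕ∞)} [IsFiniteMeasure μ]
    [IsFiniteMeasure ν]
    (h : ∀ k : ι → ℕ, ∫ N, ∏ i, (halfPow (N i) : ℝ) ^ k i ∂μ =
      ∫ N, ∏ i, (halfPow (N i) : ℝ) ^ k i ∂ν) : μ = ν := by
  let e : (ι → ℕ∞) → ι → unitInterval := fun N i => halfPow (N i)
  have hm : Measurable e :=
    measurable_pi_lambda _ fun i =>
      (Measurable.of_discrete (f := halfPow)).comp (measurable_pi_apply i)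
  have he : MeasurableEmbedding e :=
    { injective := fun M N hMN => funext fun i => halfPow_injective (congrFun hMN i)
      measurable := hm
      measurableSet_image' := fun {s} _ => (s.to_countable.image e).measurableSet }
  have hc : ∀ k : ι → ℕ, Measurable fun y : ι → unitInterval => ∏ i, (y i : ℝ) ^ k i :=
    fun k => by fun_prop
  have : μ.map e = ν.map e := ext_of_integral_prod_pow fun k => by
    rw [integral_map hm.aemeasurable (hc k).aestronglyMeasurable,
      integral_map hm.aemeasurable (hc k).aestronglyMeasurable]
    exact h k
  rw [← he.comap_map μ, this, he.comap_map]

end Uniqueness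

lemma isProbabilityMeasure_poissonENat (r : ℝ≥0∞) : IsProbabilityMeasure (poissonENat r) := by
  unfold poissonENat
  split_ifs
  · infer_instance
  · exact Measure.isProbabilityMeasure_map Measurable.of_discrete.aemeasurable

lemma integral_halfPow_pow_poissonENat {r : ℝ≥0∞} (hr : r ≠ ∞) (k : ℕ) :
    ∫ N, (halfPow N : ℝ) ^ k ∂poissonENat r = Real.exp (-(r.toReal * (1 - (1 / 2) ^ k))) := by
  rw [poissonENat, if_neg hr, integral_map Measurable.of_discrete.aemeasurable
    (Measurable.of_discrete (f := fun N : ℕ∞ => (halfPow N : ℝ) ^ k)).aestronglyMeasurable,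
    integral_poissonMeasure]
  have h := (NormedSpace.expSeries_div_hasSum_exp (r.toReal * (1 / 2) ^ k)).mul_left
    (Real.exp (-r.toReal))
  rw [← Real.exp_eq_exp_ℝ, ← Real.exp_add] at h
  have e : -(r.toReal * (1 - (1 / 2) ^ k)) = -r.toReal + r.toReal * (1 / 2) ^ k := by ring
  rw [e, ← h.tsum_eq]
  refine tsum_congr fun n => ?_
  rw [coe_halfPow_coe, smul_eq_mul, mul_pow, ← pow_mul, ← pow_mul, mul_comm n k,
    ENNReal.coe_toNNReal_eq_toReal]
  ring

/-! ### The joint law of the counts -/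

namespace Mondrian

open Classical in
/-- The function by which the joint generating function of the counts of `A` at the points `2⁻ᵏ` is
a value of the generating functional. -/
noncomputable def testFun {ι : Type*} [Fintype ι] (A : ι → Set ℝ) (k : ι → ℕ) (x : ℝ) : ℝ :=
  ∏ i, if x ∈ A i then (1 / 2) ^ k i else 1

section Counts

variable {ι : Type*} [Fintype ι] {A : ι → Set ℝ} {k : ι → ℕ}

lemma measurable_testFun (hA : ∀ i, MeasurableSet (A i)) : Measurable (testFun A k) := by
  classical
  unfold testFun
  exact Finset.measurable_prod _ fun i _ => Measurable.ite (hA i) measurable_const measurable_const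

lemma testFun_mem_Icc (x : ℝ) : testFun A k x ∈ Icc 0 1 := by
  classical
  refine ⟨Finset.prod_nonneg fun i _ => ?_, Finset.prod_le_one (fun i _ => ?_) fun i _ => ?_⟩ <;>
    split_ifs
  any_goals positivity
  · exact pow_le_one₀ (by norm_num) (by norm_num)
  · rfl

lemma integral_one_sub_testFun {a b : ℝ} (hab : a ≤ b) (hA : ∀ i, MeasurableSet (A i))
    (hs : ∀ i, A i ⊆ Icc a b) (hd : Pairwise (Function.onFun Disjoint A)) :
    ∫ x in a..b, (1 - testFun A k x) = ∑ i, volume.real (A i) * (1 - (1 / 2) ^ k i) := by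
  classical
  have hsum : ∀ x, 1 - testFun A k x =
      ∑ i, (A i).indicator (fun _ => (1 - (1 / 2) ^ k i : ℝ)) x := by
    intro x
    unfold testFun
    -- By disjointness at most one factor of the product differs from `1`.
    by_cases hx : ∃ j, x ∈ A j
    · obtain ⟨j, hj⟩ := hx
      have hn : ∀ i, i ≠ j → x ∉ A i := fun i hi h => (disjoint_left.1 (hd hi)) h hj
      rw [Finset.prod_eq_single j (fun i _ hi => if_neg (hn i hi)) (by simp),
        Finset.sum_eq_single j (fun i _ hi => indicator_of_notMem (hn i hi) _) (by simp),
        if_pos hj, indicator_of_mem hj]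
    · push Not at hx
      rw [Finset.prod_eq_one fun i _ => if_neg (hx i),
        Finset.sum_eq_zero fun i _ => indicator_of_notMem (hx i) _, sub_self]
  simp only [hsum]
  rw [intervalIntegral.integral_of_le hab, ← integral_Icc_eq_integral_Ioc, integral_finsetSum]
  · refine Finset.sum_congr rfl fun i _ => ?_
    rw [setIntegral_indicator (hA i), inter_eq_self_of_subset_right (hs i), setIntegral_const,
      smul_eq_mul]
  · exact fun i _ => (integrable_const _).indicator (hA i)

/-- The joint generating function of the counts is that of independent Poisson variables. -/
lemma integral_prod_halfPow_cutCount {a b : ℝ} (hab : a < b) (lam : ℝ≥0)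
    (hA : ∀ i, MeasurableSet (A i)) (hs : ∀ i, A i ⊆ Icc a b)
    (hd : Pairwise (Function.onFun Disjoint A)) :
    ∫ m, ∏ i, (halfPow (m.cutCount lam (A i)) : ℝ) ^ k i ∂law a b =
      ∏ i, Real.exp (-(lam * volume.real (A i) * (1 - (1 / 2) ^ k i))) := by
  classical
  set R : MondrianTree → ℝ := fun m => ∏ i, (halfPow (m.cutCount lam (A i)) : ℝ) ^ k i with hR
  have hh : Measurable fun N : ℕ∞ => (halfPow N : ℝ) := Measurable.of_discrete
  have hRm : Measurable R := Finset.measurable_prod _ fun i _ =>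
    (hh.comp (MondrianTree.measurable_cutCount lam (hA i))).pow_const _
  have hR0 : ∀ m, 0 ≤ R m := fun m =>
    Finset.prod_nonneg fun i _ => pow_nonneg (halfPow _).2.1 _
  have hR1 : ∀ m, R m ≤ 1 := fun m =>
    Finset.prod_le_one (fun i _ => pow_nonneg (halfPow _).2.1 _)
      fun i _ => pow_le_one₀ (halfPow _).2.1 (halfPow _).2.2
  have hnode : ∀ tb tc x l r, ENNReal.ofReal (R (MondrianTree.node tb tc x l r)) =
      cutWeight (testFun A k) lam tc x * ENNReal.ofReal (R l) * ENNReal.ofReal (R r) := by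
    intro tb tc x l r
    have h1 : cutWeight (testFun A k) lam tc x =
        ENNReal.ofReal (∏ i, (halfPow (if tc ≤ lam ∧ x ∈ A i then 1 else 0) : ℝ) ^ k i) := by
      have one : (halfPow 1 : ℝ) = 1 / 2 := by simpa using coe_halfPow_coe 1
      have zero : (halfPow 0 : ℝ) = 1 := by simpa using coe_halfPow_coe 0
      unfold cutWeight testFun
      split_ifs with h
      · congr 1
        refine Finset.prod_congr rfl fun i _ => ?_
        by_cases hx : x ∈ A i <;> simp [h, hx, one, zero]
      · simp [h, zero]
    rw [h1, ← ENNReal.ofReal_mul (Finset.prod_nonneg fun i _ => pow_nonneg (halfPow _).2.1 _),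
      ← ENNReal.ofReal_mul, hR]
    · simp only [MondrianTree.cutCount_node, coe_halfPow_add, mul_pow, Finset.prod_mul_distrib]
    · exact mul_nonneg (Finset.prod_nonneg fun i _ => pow_nonneg (halfPow _).2.1 _) (hR0 l)
  have hlate : ∀ a b t₀, a < b → (lam : ℝ) < t₀ →
      ∀ᵐ m ∂startedAt a b t₀, ENNReal.ofReal (R m) = 1 := by
    intro a b t₀ h ht
    filter_upwards [ae_isProper h t₀] with m hm
    have zero : (halfPow 0 : ℝ) = 1 := by simpa using coe_halfPow_coe 0
    simp [hR, hm.cutCount_eq_zero ht, zero]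
  have key := lintegral_eq_poissonGF (measurable_testFun (k := k) hA) testFun_mem_Icc
    hRm.ennreal_ofReal (fun m => ENNReal.ofReal_le_one.2 (hR1 m)) hnode hlate hab lam.coe_nonneg
  rw [integral_eq_lintegral_of_nonneg_ae (Filter.Eventually.of_forall hR0)
    hRm.aestronglyMeasurable, law, key, ENNReal.toReal_ofReal (poissonGF_nonneg ..), sub_zero,
    poissonGF_of_nonneg _ _ _ lam.coe_nonneg, integral_one_sub_testFun hab.le hA hs hd, Finset.mul_sum,
    ← Finset.sum_neg_distrib, Real.exp_sum]
  simp only [mul_assoc]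

/-- The counts of the cuts in disjoint Borel sets are independent Poisson variables. -/
theorem map_cutCount_law {a b : ℝ} (hab : a < b) (lam : ℝ≥0)
    (hA : ∀ i, MeasurableSet (A i)) (hs : ∀ i, A i ⊆ Icc a b)
    (hd : Pairwise (Function.onFun Disjoint A)) :
    (law a b).map (fun m i => m.cutCount lam (A i)) =
      Measure.pi fun i => poissonENat (lam * volume (A i)) := by
  have := fun i => isProbabilityMeasure_poissonENat (lam * volume (A i))
  have hm : Measurable fun (m : MondrianTree) i => m.cutCount lam (A i) :=
    measurable_pi_lambda _ fun i => MondrianTree.measurable_cutCount lam (hA i)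
  have := Measure.isProbabilityMeasure_map (μ := law a b) hm.aemeasurable
  refine ext_of_integral_prod_halfPow_pow fun k => ?_
  rw [integral_map hm.aemeasurable, integral_prod_halfPow_cutCount hab lam hA hs hd,
    integral_fintype_prod_eq_prod (f := fun i (N : ℕ∞) => (halfPow N : ℝ) ^ k i)]
  · refine Finset.prod_congr rfl fun i _ => ?_
    have hfin : volume (A i) ≠ ∞ := measure_ne_top_of_subset (hs i) (by simp)
    rw [integral_halfPow_pow_poissonENat (ENNReal.mul_ne_top ENNReal.coe_ne_top hfin)]
    simp [ENNReal.toReal_mul, measureReal_def]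
  · have hh : Measurable fun N : ℕ∞ => (halfPow N : ℝ) := Measurable.of_discrete
    exact (Finset.measurable_prod _ fun i _ =>
      (hh.comp (measurable_pi_apply i)).pow_const _).aestronglyMeasurable

end Counts

end Mondrian

/-! ### The cut locations form a Poisson process -/

theorem mainTheorem3 (a b : ℝ) (hab : a < b) (lam : ℝ≥0)
    {Ω : Type*} [MeasurableSpace Ω] (P : Measure Ω) [IsProbabilityMeasure P]
    (M : Ω → MondrianTree) (hM : HasLaw M (Mondrian.law a b) P) :
    IsPoissonPointProcess (fun ω => (M ω).cutLocations lam) (Icc a b) lam P := by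
  have hproper : ∀ᵐ ω ∂P, (M ω).IsProper a b 0 :=
    ae_of_ae_map hM.aemeasurable (by rw [hM.map_eq]; exact Mondrian.ae_isProper hab 0)
  have hcount : ∀ A : Set ℝ,
      (fun ω => ((M ω).cutLocations lam ∩ A).encard) =ᵐ[P] fun ω => (M ω).cutCount lam A :=
    fun A => hproper.mono fun ω h => h.encard_inter lam A
  have hmeas : ∀ {A : Set ℝ}, MeasurableSet A →
      AEMeasurable (fun ω => (M ω).cutCount lam A) P := fun hA =>
    (MondrianTree.measurable_cutCount lam hA).comp_aemeasurable hM.aemeasurable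
  have hjoint : ∀ (n : ℕ) (A : Fin n → Set ℝ), (∀ i, MeasurableSet (A i)) →
      (∀ i, A i ⊆ Icc a b) → Pairwise (Function.onFun Disjoint A) →
      P.map (fun ω i => (M ω).cutCount lam (A i)) =
        Measure.pi fun i => poissonENat (lam * volume (A i)) := by
    intro n A hA hs hd
    rw [← Mondrian.map_cutCount_law hab lam hA hs hd, ← hM.map_eq,
      AEMeasurable.map_map_of_aemeasurable _ hM.aemeasurable]
    · rfl
    · exact (measurable_pi_lambda _ fun i =>
        MondrianTree.measurable_cutCount lam (hA i)).aemeasurable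
  have hlaw : ∀ A : Set ℝ, MeasurableSet A → A ⊆ Icc a b →
      P.map (fun ω => (M ω).cutCount lam A) = poissonENat (lam * volume A) := by
    intro A hA hs
    have := isProbabilityMeasure_poissonENat (lam * volume A)
    have h := hjoint 1 (fun _ => A) (fun _ => hA) (fun _ => hs)
      (fun i j hij => absurd (Subsingleton.elim i j) hij)
    have h' := congrArg (Measure.map (Function.eval 0)) h
    rw [(measurePreserving_eval (fun _ : Fin 1 => poissonENat (lam * volume A)) 0).map_eq,
      AEMeasurable.map_map_of_aemeasurable (measurable_pi_apply _).aemeasurable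
        (aemeasurable_pi_lambda _ fun _ => hmeas hA)] at h'
    exact h'
  refine ⟨?_, ?_, ?_, ?_⟩
  · refine Filter.Eventually.of_forall fun ω => ?_
    refine (countable_range (M ω).cutLocation).mono ?_
    rintro x ⟨w, -, rfl⟩
    exact mem_range_self w
  · filter_upwards [hproper] with ω h
    rintro x ⟨w, -, rfl⟩
    exact Ioo_subset_Icc_self (h.cutLocation_mem w)
  · intro A hA hs
    exact HasLaw.congr ⟨hmeas hA, hlaw A hA hs⟩ (hcount A)
  · intro n A hA hs hd
    refine iIndepFun.congr (fun i => (hcount (A i)).symm) ?_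
    rw [iIndepFun_iff_map_fun_eq_pi_map fun i => hmeas (hA i), hjoint n A hA hs hd]
    simp only [hlaw _ (hA _) (hs _)]
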